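/- Let $\Bbbk$ be a field of characteristic $\neq 2$. Let $P=(P_0,P_1,P_2,P_3)$ be a $(3,2)$-superpolygraph over $\Bbbk$: $(P_0,P_1)$ is a directed graph with free category $P_1^*$; $P_2$ is a $\mathbb Z/2$-graded set of generating 2-cells with parallel source and target in $P_1^*$; and $P_3$ is a $\mathbb Z/2$-graded set of generating 3-cells $\alpha$ with parity-preserving source and target $s_2(\alpha),t_2(\alpha)$, which are parallel 2-cells of the free 2-supercategory $P_2^s$ over $\Bbbk$ on $(P_0,P_1,P_2)$. Let $U(P)_2^*$ be the free (strict) 2-category on $(P_0,P_1,P_2)$ with parities forgotten. A \emph{monomial} of $P_2^s$ is a nonzero 2-cell that is represented by a formal composite of generating 2-cells and identities. Every 2-cell $u$ of $P_2^s$ is a linear combination, with nonzero coefficients, of monomials with pairwise distinct underlying 2-cells in $U(P)_2^*$; $\mathrm{Supp}(u)$ is the set of underlying 2-cells that appear. Assume that $P$ is left-monomial, i.e. each $s_2(\alpha)$ is a monomial; below, $s_2(\alpha)$ also denotes its underlying 2-cell in $U(P)_2^*$. A \emph{rewriting step} is $$\lambda\, m_1\star_1(m_2\star_0 s_2(\alpha)\star_0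 m_3)\star_1 m_4+u\ \to\ \lambda\, m_1\star_1(m_2\star_0 t_2(\alpha)\star_0 m_3)\star_1 m_4+u,$$ where $\alpha\in P_3$, $\lambda\in\Bbbk\setminus\{0\}$, the $m_i$ are monomials, $u$ is a 2-cell of $P_2^s$, and $m_1\star_1(m_2\star_0 s_2(\alpha)\star_0 m_3)\star_1 m_4$ is a monomial (in particular nonzero) that does not appear in the monomial decomposition of $u$. $P$ \emph{terminates} if there is no infinite sequence of composable rewriting steps. Let $\mathrm{Ord}$ be the category of partially ordered sets and monotone maps, seen through its cartesian product as a 2-category with one object. Suppose that there exist: 1. 2-functors $X:U(P)_2^*\to\mathrm{Ord}$ and $Y:(U(P)_2^*)^{\mathrm{co}}\to\mathrm{Ord}$ (2-cells reversed), i.e. with $X(p\star_0 q)=X(p)\times X(q)$, $Y(p\star_0 q)=Y(p)\times Y(q)$ and, for $u:p\Rightarrow q$, monotone maps $X(u):X(p)\to X(q)$ and $Y(u):Y(q)\to Y(p)$, such that $X(p)$ and $Y(p)$ are non-empty for every $p\in P_1$ and, for every $\alpha\in P_3$ and $h\in\mathrm{Supp}(t_2(\alpha))$, $X(s_2(\alpha))\ge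 X(h)$ and $Y(s_2(\alpha))\ge Y(h)$ pointwise; 2. a partially ordered abelian group $G$ whose addition is strictly monotone in both arguments and in which every decreasing sequence of non-negative elements is stationary; 3. a derivation $d$ of $U(P)_2^*$ into the module $M_{X,Y,G}$. That is, $d$ assigns to every 2-cell $u:p\Rightarrow q$ a monotone map $d(u):X(p)\times Y(q)\to G$, such that for $u:p\Rightarrow q$ and $v:q\Rightarrow r$ $$d(u\star_1 v)(x,y)=d(v)(X(u)(x),y)+d(u)(x,Y(v)(y)),$$ and for 0-composable $u,v$ $$d(u\star_0 v)((x,x'),(y,y'))=d(v)(x',y')+d(u)(x,y).$$ Moreover $d(u)\ge 0$ pointwise for every 2-cell $u$ of $U(P)_2^*$ and, for every $\alpha\in P_3$ and $h\in\mathrm{Supp}(t_2(\alpha))$, $d(s_2(\alpha))(x,y)>d(h)(x,y)$ at every point $(x,y)$. Then $P$ terminates. -/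

import Mathlib

universe u v w w₃ x k

namespace SuperRewriting

open Quiver (Path)

/-! ### 2-polygraphs, pasting diagrams and the free 2-category -/

/-- A 2-polygraph over the 1-polygraph given by a quiver `V`: the 0-cells are the elements of `V`,
the generating 1-cells are the arrows, the free 1-category is the category of paths, and the
generating 2-cells are given together with their (globular) source and target paths. -/
structure TwoPolygraph (V : Type u) [Quiver.{v} V] where
  Gen : {a b : V} → Path a b → Path a b → Type w

/-- A 2-superpolygraph: the generating 2-cells carry a parity. -/
structure TwoSuperpolygraph (V : Type u) [Quiver.{v} V] extends TwoPolygraph.{u, v, w} V where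
  parity : {a b : V} → {p q : Path a b} → Gen p q → ZMod 2

/-- Formal composites of generating 2-cells and identities. The 1-source and 1-target of a
horizontal composite are given up to a propositional equality, so that no transport is needed to
compare two bracketings of a horizontal composite. -/
inductive Past {V : Type u} [Quiver.{v} V] (P : TwoPolygraph.{u, v, w} V) :
    {a b : V} → Path a b → Path a b → Type (max u v w)
  | gen {a b : V} {p q : Path a b} (α : P.Gen p q) : Past P p q
  | id {a b : V} (p : Path a b) : Past P p p
  | vcomp {a b : V} {p q r : Path a b} (D : Past P p q) (E : Past P q r) : Past P p r
  | hcomp {a b c : V} {p q : Path a b} {p' q' : Path b c} {s t : Path a c}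
      (D : Past P p q) (E : Past P p' q') (hs : s = p.comp p') (ht : t = q.comp q') : Past P s t

/-- The congruence on formal composites generated by the axioms of a (strict) 2-category:
associativity, identities, and the exchange law. -/
inductive Exch {V : Type u} [Quiver.{v} V] (P : TwoPolygraph.{u, v, w} V) :
    {a b : V} → {p q : Path a b} → Past P p q → Past P p q → Prop
  | refl {a b : V} {p q : Path a b} (D : Past P p q) : Exch P D D
  | symm {a b : V} {p q : Path a b} {D D' : Past P p q} : Exch P D D' → Exch P D' D
  | trans {a b : V} {p q : Path a b} {D D' D'' : Past P p q} :
      Exch P D D' → Exch P D' D'' → Exch P D D''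
  | vcomp_congr {a b : V} {p q r : Path a b} {D D' : Past P p q} {E E' : Past P q r} :
      Exch P D D' → Exch P E E' → Exch P (D.vcomp E) (D'.vcomp E')
  | hcomp_congr {a b c : V} {p q : Path a b} {p' q' : Path b c} {s t : Path a c}
      {D D' : Past P p q} {E E' : Past P p' q'} (hs : s = p.comp p') (ht : t = q.comp q') :
      Exch P D D' → Exch P E E' → Exch P (D.hcomp E hs ht) (D'.hcomp E' hs ht)
  | vassoc {a b : V} {p q r s : Path a b} (D : Past P p q) (E : Past P q r) (F : Past P r s) :
      Exch P ((D.vcomp E).vcomp F) (D.vcomp (E.vcomp F))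
  | id_vcomp {a b : V} {p q : Path a b} (D : Past P p q) : Exch P ((Past.id p).vcomp D) D
  | vcomp_id {a b : V} {p q : Path a b} (D : Past P p q) : Exch P (D.vcomp (Past.id q)) D
  | hassoc {a b c e : V} {p q : Path a b} {p' q' : Path b c} {p'' q'' : Path c e}
      (D : Past P p q) (E : Past P p' q') (F : Past P p'' q'') :
      Exch P ((D.hcomp E rfl rfl).hcomp F rfl rfl)
        (D.hcomp (E.hcomp F rfl rfl) (Path.comp_assoc p p' p'') (Path.comp_assoc q q' q''))
  | id_hcomp {a b : V} {p q : Path a b} (D : Past P p q) :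
      Exch P ((Past.id (Path.nil : Path a a)).hcomp D
        (Path.nil_comp p).symm (Path.nil_comp q).symm) D
  | hcomp_id {a b : V} {p q : Path a b} (D : Past P p q) :
      Exch P (D.hcomp (Past.id (Path.nil : Path b b))
        (Path.comp_nil p).symm (Path.comp_nil q).symm) D
  | id_hcomp_id {a b c : V} (p : Path a b) (p' : Path b c) :
      Exch P ((Past.id p).hcomp (Past.id p') rfl rfl) (Past.id (p.comp p'))
  | exchange {a b c : V} {p q r : Path a b} {p' q' r' : Path b c}
      (D : Past P p q) (E : Past P p' q') (D' : Past P q r) (E' : Past P q' r') :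
      Exch P ((D.hcomp E rfl rfl).vcomp (D'.hcomp E' rfl rfl))
        ((D.vcomp D').hcomp (E.vcomp E') rfl rfl)

/-- The setoid of the exchange congruence. -/
def exchSetoid {V : Type u} [Quiver.{v} V] (P : TwoPolygraph.{u, v, w} V) {a b : V}
    (p q : Path a b) : Setoid (Past P p q) where
  r := Exch P
  iseqv := ⟨Exch.refl, Exch.symm, Exch.trans⟩

/-- The 2-cells `p ⇒ q` of the free 2-category on a 2-polygraph. -/
def Cell {V : Type u} [Quiver.{v} V] (P : TwoPolygraph.{u, v, w} V) {a b : V}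
    (p q : Path a b) : Type (max u v w) :=
  Quotient (exchSetoid P p q)

namespace Cell

variable {V : Type u} [Quiver.{v} V] {P : TwoPolygraph.{u, v, w} V}

/-- The 2-cell represented by a formal composite. -/
def mk {a b : V} {p q : Path a b} (D : Past P p q) : Cell P p q :=
  Quotient.mk (exchSetoid P p q) D

/-- The identity 2-cell. -/
def id {a b : V} (p : Path a b) : Cell P p p := mk (Past.id p)

/-- The vertical composite `u ⋆₁ v`. -/
def vcomp {a b : V} {p q r : Path a b} (x : Cell P p q) (y : Cell P q r) : Cell P p r :=
  Quotient.map₂ Past.vcomp (fun _ _ h _ _ h' => Exch.vcomp_congr h h') x y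

/-- The horizontal composite `u ⋆₀ v`. -/
def hcomp {a b c : V} {p q : Path a b} {p' q' : Path b c} (x : Cell P p q) (y : Cell P p' q') :
    Cell P (p.comp p') (q.comp q') :=
  Quotient.map₂ (fun D E => Past.hcomp D E rfl rfl)
    (fun _ _ h _ _ h' => Exch.hcomp_congr rfl rfl h h') x y

end Cell

/-! ### The free 2-supercategory -/

/-- The parity of a formal composite. -/
def Past.parity {V : Type u} [Quiver.{v} V] (P : TwoSuperpolygraph.{u, v, w} V) :
    {a b : V} → {p q : Path a b} → Past P.toTwoPolygraph p q → ZMod 2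
  | _, _, _, _, .gen α => P.parity α
  | _, _, _, _, .id _ => 0
  | _, _, _, _, .vcomp D E => Past.parity P D + Past.parity P E
  | _, _, _, _, .hcomp D E _ _ => Past.parity P D + Past.parity P E

/-- `SExch P ε D D'` says that the equality `D = ε D'`, with `ε = ±1`, follows from the axioms of a
2-supercategory: associativity, identities, and the superinterchange law
`(D ⋆₀ E) ⋆₁ (D' ⋆₀ E') = (-1)^(|E||D'|) (D ⋆₁ D') ⋆₀ (E ⋆₁ E')`. -/
inductive SExch {V : Type u} [Quiver.{v} V] (P : TwoSuperpolygraph.{u, v, w} V) :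
    ℤˣ → {a b : V} → {p q : Path a b} →
      Past P.toTwoPolygraph p q → Past P.toTwoPolygraph p q → Prop
  | refl {a b : V} {p q : Path a b} (D : Past P.toTwoPolygraph p q) : SExch P 1 D D
  | symm {ε : ℤˣ} {a b : V} {p q : Path a b} {D D' : Past P.toTwoPolygraph p q} :
      SExch P ε D D' → SExch P ε D' D
  | trans {ε δ : ℤˣ} {a b : V} {p q : Path a b} {D D' D'' : Past P.toTwoPolygraph p q} :
      SExch P ε D D' → SExch P δ D' D'' → SExch P (ε * δ) D D''
  | vcomp_congr {ε δ : ℤˣ} {a b : V} {p q r : Path a b} {D D' : Past P.toTwoPolygraph p q}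
      {E E' : Past P.toTwoPolygraph q r} :
      SExch P ε D D' → SExch P δ E E' → SExch P (ε * δ) (D.vcomp E) (D'.vcomp E')
  | hcomp_congr {ε δ : ℤˣ} {a b c : V} {p q : Path a b} {p' q' : Path b c} {s t : Path a c}
      {D D' : Past P.toTwoPolygraph p q} {E E' : Past P.toTwoPolygraph p' q'}
      (hs : s = p.comp p') (ht : t = q.comp q') :
      SExch P ε D D' → SExch P δ E E' →
        SExch P (ε * δ) (D.hcomp E hs ht) (D'.hcomp E' hs ht)
  | vassoc {a b : V} {p q r s : Path a b} (D : Past P.toTwoPolygraph p q)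
      (E : Past P.toTwoPolygraph q r) (F : Past P.toTwoPolygraph r s) :
      SExch P 1 ((D.vcomp E).vcomp F) (D.vcomp (E.vcomp F))
  | id_vcomp {a b : V} {p q : Path a b} (D : Past P.toTwoPolygraph p q) :
      SExch P 1 ((Past.id p).vcomp D) D
  | vcomp_id {a b : V} {p q : Path a b} (D : Past P.toTwoPolygraph p q) :
      SExch P 1 (D.vcomp (Past.id q)) D
  | hassoc {a b c e : V} {p q : Path a b} {p' q' : Path b c} {p'' q'' : Path c e}
      (D : Past P.toTwoPolygraph p q) (E : Past P.toTwoPolygraph p' q')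
      (F : Past P.toTwoPolygraph p'' q'') :
      SExch P 1 ((D.hcomp E rfl rfl).hcomp F rfl rfl)
        (D.hcomp (E.hcomp F rfl rfl) (Path.comp_assoc p p' p'') (Path.comp_assoc q q' q''))
  | id_hcomp {a b : V} {p q : Path a b} (D : Past P.toTwoPolygraph p q) :
      SExch P 1 ((Past.id (Path.nil : Path a a)).hcomp D
        (Path.nil_comp p).symm (Path.nil_comp q).symm) D
  | hcomp_id {a b : V} {p q : Path a b} (D : Past P.toTwoPolygraph p q) :
      SExch P 1 (D.hcomp (Past.id (Path.nil : Path b b))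
        (Path.comp_nil p).symm (Path.comp_nil q).symm) D
  | id_hcomp_id {a b c : V} (p : Path a b) (p' : Path b c) :
      SExch P 1 ((Past.id p).hcomp (Past.id p') rfl rfl) (Past.id (p.comp p'))
  | superinterchange {a b c : V} {p q r : Path a b} {p' q' r' : Path b c}
      (D : Past P.toTwoPolygraph p q) (E : Past P.toTwoPolygraph p' q')
      (D' : Past P.toTwoPolygraph q r) (E' : Past P.toTwoPolygraph q' r') :
      SExch P ((-1 : ℤˣ) ^ (E.parity P * D'.parity P))
        ((D.hcomp E rfl rfl).vcomp (D'.hcomp E' rfl rfl))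
        ((D.vcomp D').hcomp (E.vcomp E') rfl rfl)

/-- The linear span of the relations `D - ε D'` imposed on the free superspace on formal
composites. -/
noncomputable def relations {V : Type u} [Quiver.{v} V] (P : TwoSuperpolygraph.{u, v, w} V)
    (𝕜 : Type*) [Field 𝕜] {a b : V} (p q : Path a b) :
    Submodule 𝕜 (Past P.toTwoPolygraph p q →₀ 𝕜) :=
  Submodule.span 𝕜 {z | ∃ (ε : ℤˣ) (D D' : Past P.toTwoPolygraph p q), SExch P ε D D' ∧
    z = Finsupp.single D 1 - ((ε : ℤ) : 𝕜) • Finsupp.single D' 1}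

/-- The superspace of 2-cells `p ⇒ q` of the free 2-supercategory on a 2-superpolygraph. -/
abbrev SCell {V : Type u} [Quiver.{v} V] (P : TwoSuperpolygraph.{u, v, w} V)
    (𝕜 : Type*) [Field 𝕜] {a b : V} (p q : Path a b) :=
  (Past P.toTwoPolygraph p q →₀ 𝕜) ⧸ relations P 𝕜 p q

namespace SCell

variable {V : Type u} [Quiver.{v} V] {P : TwoSuperpolygraph.{u, v, w} V}
  {𝕜 : Type*} [Field 𝕜]

/-- The 2-cell represented by a formal composite. -/
noncomputable def ofPast (𝕜 : Type*) [Field 𝕜] {a b : V} {p q : Path a b}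
    (D : Past P.toTwoPolygraph p q) : SCell P 𝕜 p q :=
  (relations P 𝕜 p q).mkQ (Finsupp.single D 1)

theorem ofPast_eq {a b : V} {p q : Path a b} {ε : ℤˣ} {D D' : Past P.toTwoPolygraph p q}
    (h : SExch P ε D D') : ofPast 𝕜 D = ((ε : ℤ) : 𝕜) • ofPast 𝕜 D' := by
  rw [ofPast, ofPast, ← map_smul, ← sub_eq_zero, ← map_sub]
  exact (Submodule.Quotient.mk_eq_zero _).2 (Submodule.subset_span ⟨ε, D, D', h, rfl⟩)

/-- A linear map out of the space of 2-cells is given by its values on formal composites. -/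
noncomputable def lift {M : Type*} [AddCommGroup M] [Module 𝕜 M] {a b : V} {p q : Path a b}
    (f : Past P.toTwoPolygraph p q → M)
    (hf : ∀ (ε : ℤˣ) (D D' : Past P.toTwoPolygraph p q), SExch P ε D D' →
      f D = ((ε : ℤ) : 𝕜) • f D') : SCell P 𝕜 p q →ₗ[𝕜] M :=
  (relations P 𝕜 p q).liftQ (Finsupp.linearCombination 𝕜 f) (by
    rw [relations, Submodule.span_le]
    rintro _ ⟨ε, D, D', h, rfl⟩
    simp only [SetLike.mem_coe, LinearMap.mem_ker, map_sub, map_smul,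
      Finsupp.linearCombination_single, one_smul]
    rw [hf ε D D' h, sub_self])

theorem lift_ofPast {M : Type*} [AddCommGroup M] [Module 𝕜 M] {a b : V} {p q : Path a b}
    (f : Past P.toTwoPolygraph p q → M)
    (hf : ∀ (ε : ℤˣ) (D D' : Past P.toTwoPolygraph p q), SExch P ε D D' →
      f D = ((ε : ℤ) : 𝕜) • f D') (D : Past P.toTwoPolygraph p q) :
    lift f hf (ofPast 𝕜 D) = f D := by
  simp [lift, ofPast]

theorem hom_ext {M : Type*} [AddCommGroup M] [Module 𝕜 M] {a b : V} {p q : Path a b}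
    {f g : SCell P 𝕜 p q →ₗ[𝕜] M} (h : ∀ D, f (ofPast 𝕜 D) = g (ofPast 𝕜 D)) : f = g := by
  refine Submodule.linearMap_qext _ (Finsupp.lhom_ext' fun D => LinearMap.ext_ring ?_)
  exact h D

/-- The vertical composition `⋆₁`, extended bilinearly from formal composites. -/
noncomputable def vcomp {a b : V} {p q r : Path a b} :
    SCell P 𝕜 p q →ₗ[𝕜] SCell P 𝕜 q r →ₗ[𝕜] SCell P 𝕜 p r :=
  lift (fun D => lift (fun E => ofPast 𝕜 (D.vcomp E)) (fun ε E E' h => by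
      simpa using ofPast_eq (𝕜 := 𝕜) (SExch.vcomp_congr (SExch.refl D) h)))
    (fun ε D D' h => hom_ext fun E => by
      rw [LinearMap.smul_apply, lift_ofPast, lift_ofPast]
      simpa using ofPast_eq (𝕜 := 𝕜) (SExch.vcomp_congr h (SExch.refl E)))

/-- The horizontal composition `⋆₀`, extended bilinearly from formal composites. -/
noncomputable def hcomp {a b c : V} {p q : Path a b} {p' q' : Path b c} :
    SCell P 𝕜 p q →ₗ[𝕜] SCell P 𝕜 p' q' →ₗ[𝕜] SCell P 𝕜 (p.comp p') (q.comp q') :=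
  lift (fun D => lift (fun E => ofPast 𝕜 (D.hcomp E rfl rfl)) (fun ε E E' h => by
      simpa using ofPast_eq (𝕜 := 𝕜) (SExch.hcomp_congr rfl rfl (SExch.refl D) h)))
    (fun ε D D' h => hom_ext fun E => by
      rw [LinearMap.smul_apply, lift_ofPast, lift_ofPast]
      simpa using ofPast_eq (𝕜 := 𝕜) (SExch.hcomp_congr rfl rfl h (SExch.refl E)))

/-- The homogeneous part of parity `e`. -/
noncomputable def homogeneous (P : TwoSuperpolygraph.{u, v, w} V) (𝕜 : Type*) [Field 𝕜] {a b : V}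
    (p q : Path a b) (e : ZMod 2) : Submodule 𝕜 (SCell P 𝕜 p q) :=
  Submodule.span 𝕜 {z | ∃ D : Past P.toTwoPolygraph p q, D.parity P = e ∧ z = ofPast 𝕜 D}

/-- A monomial: a nonzero 2-cell represented by a formal composite. -/
def IsMonomial {a b : V} {p q : Path a b} (z : SCell P 𝕜 p q) : Prop :=
  z ≠ 0 ∧ ∃ D : Past P.toTwoPolygraph p q, z = ofPast 𝕜 D

/-- `c` is a monomial decomposition of `z`: it writes `z` as a linear combination, with nonzero
coefficients, of monomials with pairwise distinct underlying 2-cells in the free 2-category on the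
underlying 2-polygraph. -/
def IsMonomialDecomposition {a b : V} {p q : Path a b} (z : SCell P 𝕜 p q)
    (c : Past P.toTwoPolygraph p q →₀ 𝕜) : Prop :=
  (∀ D ∈ c.support, IsMonomial (ofPast 𝕜 D)) ∧
  Set.InjOn (Cell.mk : Past P.toTwoPolygraph p q → Cell P.toTwoPolygraph p q)
    {D | D ∈ c.support} ∧
  z = c.sum fun D k => k • ofPast 𝕜 D

/-- The support of a 2-cell: the monomials, seen as 2-cells of the free 2-category on the underlying
2-polygraph, that appear in the monomial decomposition. -/
def Supp {a b : V} {p q : Path a b} (z : SCell P 𝕜 p q) : Set (Cell P.toTwoPolygraph p q) :=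
  {h | ∃ c : Past P.toTwoPolygraph p q →₀ 𝕜, IsMonomialDecomposition z c ∧
    ∃ D ∈ c.support, Cell.mk D = h}

end SCell

/-- A context `k m₁ ⋆₁ (m₂ ⋆₀ S ⋆₀ m₃) ⋆₁ m₄ + rest` of the free 2-supercategory, with a hole `S` of
boundary `(p, q)`, a nonzero scalar `k` and monomials `mᵢ`. -/
structure SuperContext {V : Type u} [Quiver.{v} V] (P : TwoSuperpolygraph.{u, v, w} V)
    (𝕜 : Type*) [Field 𝕜] {a b : V} (p q : Path a b) {a' b' : V} (p' q' : Path a' b') where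
  {f f' : Path a' a}
  {g g' : Path b b'}
  scalar : 𝕜
  m₁ : SCell P 𝕜 p' (f.comp (p.comp g))
  m₂ : SCell P 𝕜 f f'
  m₃ : SCell P 𝕜 g g'
  m₄ : SCell P 𝕜 (f'.comp (q.comp g')) q'
  rest : SCell P 𝕜 p' q'
  scalar_ne : scalar ≠ 0
  isMonomial₁ : m₁.IsMonomial
  isMonomial₂ : m₂.IsMonomial
  isMonomial₃ : m₃.IsMonomial
  isMonomial₄ : m₄.IsMonomial

namespace SuperContext

variable {V : Type u} [Quiver.{v} V] {P : TwoSuperpolygraph.{u, v, w} V}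
  {𝕜 : Type*} [Field 𝕜] {a b : V} {p q : Path a b} {a' b' : V} {p' q' : Path a' b'}

/-- The 2-cell `m₁ ⋆₁ (m₂ ⋆₀ z ⋆₀ m₃) ⋆₁ m₄`. -/
noncomputable def plug (c : SuperContext P 𝕜 p q p' q') (z : SCell P 𝕜 p q) : SCell P 𝕜 p' q' :=
  SCell.vcomp c.m₁ (SCell.vcomp (SCell.hcomp c.m₂ (SCell.hcomp z c.m₃)) c.m₄)

/-- The 2-cell `c[z] = k m₁ ⋆₁ (m₂ ⋆₀ z ⋆₀ m₃) ⋆₁ m₄ + rest`. -/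
noncomputable def fill (c : SuperContext P 𝕜 p q p' q') (z : SCell P 𝕜 p q) : SCell P 𝕜 p' q' :=
  c.scalar • c.plug z + c.rest

end SuperContext

/-! ### (3,2)-superpolygraphs and termination -/

/-- A (3,2)-superpolygraph: generating 3-cells with a parity, and even source and target maps to
parallel 2-cells of the free 2-supercategory. -/
structure ThreeTwoSuperpolygraph (V : Type u) [Quiver.{v} V] (𝕜 : Type k) [Field 𝕜] extends
    TwoSuperpolygraph.{u, v, w} V where
  Gen₃ : {a b : V} → Path a b → Path a b → Type w₃
  parity₃ : {a b : V} → {p q : Path a b} → Gen₃ p q → ZMod 2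
  src : {a b : V} → {p q : Path a b} → Gen₃ p q → SCell toTwoSuperpolygraph 𝕜 p q
  tgt : {a b : V} → {p q : Path a b} → Gen₃ p q → SCell toTwoSuperpolygraph 𝕜 p q
  src_mem : ∀ {a b : V} {p q : Path a b} (α : Gen₃ p q),
    src α ∈ SCell.homogeneous toTwoSuperpolygraph 𝕜 p q (parity₃ α)
  tgt_mem : ∀ {a b : V} {p q : Path a b} (α : Gen₃ p q),
    tgt α ∈ SCell.homogeneous toTwoSuperpolygraph 𝕜 p q (parity₃ α)

namespace ThreeTwoSuperpolygraph

variable {V : Type u} [Quiver.{v} V] {𝕜 : Type k} [Field 𝕜]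

/-- The underlying 2-polygraph, obtained by forgetting parities (and 3-cells). -/
abbrev U (P : ThreeTwoSuperpolygraph.{u, v, w, w₃, k} V 𝕜) : TwoPolygraph.{u, v, w} V :=
  P.toTwoSuperpolygraph.toTwoPolygraph

/-- Every generating 3-cell has a monomial as source. -/
def LeftMonomial (P : ThreeTwoSuperpolygraph.{u, v, w, w₃, k} V 𝕜) : Prop :=
  ∀ {a b : V} {p q : Path a b} (α : P.Gen₃ p q), (P.src α).IsMonomial

/-- There is a rewriting step from `x` to `y`: `x = c[src α]` and `y = c[tgt α]` for a generating
3-cell `α` and a context `c`, where `m₁ ⋆₁ (m₂ ⋆₀ src α ⋆₀ m₃) ⋆₁ m₄` is a monomial that does not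
appear in the monomial decomposition of the additive part of `c`. -/
def RewritingStep (P : ThreeTwoSuperpolygraph.{u, v, w, w₃, k} V 𝕜) {a' b' : V} {p' q' : Path a' b'}
    (x y : SCell P.toTwoSuperpolygraph 𝕜 p' q') : Prop :=
  ∃ (a b : V) (p q : Path a b) (α : P.Gen₃ p q)
    (c : SuperContext P.toTwoSuperpolygraph 𝕜 p q p' q'),
    (c.plug (P.src α)).IsMonomial ∧
    Disjoint (c.plug (P.src α)).Supp c.rest.Supp ∧
    x = c.fill (P.src α) ∧ y = c.fill (P.tgt α)

/-- There is no infinite rewriting sequence. -/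
def Terminates (P : ThreeTwoSuperpolygraph.{u, v, w, w₃, k} V 𝕜) : Prop :=
  ∀ {a b : V} (p q : Path a b),
    ¬ ∃ z : ℕ → SCell P.toTwoSuperpolygraph 𝕜 p q, ∀ n, P.RewritingStep (z n) (z (n + 1))

end ThreeTwoSuperpolygraph

/-! ### 2-functors to ordered sets -/

/-- The part of a 2-functor to `Ord` (ordered sets with the cartesian product, seen as a 2-category
with one object) that concerns 1-cells: an ordered set for each 1-cell, with
`X(p ⋆₀ q) = X(p) × X(q)` and `X(1) = *` as coherent identifications. -/
structure OrdFamily (V : Type u) [Quiver.{v} V] where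
  obj : {a b : V} → Path a b → PartOrd.{x}
  unit : (a : V) → obj (Path.nil : Path a a) ≃o PUnit.{x + 1}
  prod : {a b c : V} → {s : Path a c} → (p : Path a b) → (q : Path b c) → s = p.comp q →
    obj s ≃o obj p × obj q
  prod_assoc : ∀ {a b c e : V} (p : Path a b) (q : Path b c) (r : Path c e)
    (x : obj ((p.comp q).comp r)),
    prod p q rfl (prod (p.comp q) r rfl x).1 =
        ((prod p (q.comp r) (Path.comp_assoc p q r) x).1,
          (prod q r rfl (prod p (q.comp r) (Path.comp_assoc p q r) x).2).1) ∧
      (prod (p.comp q) r rfl x).2 =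
        (prod q r rfl (prod p (q.comp r) (Path.comp_assoc p q r) x).2).2
  nil_prod : ∀ {a b : V} (p : Path a b) (x : obj p),
    (prod (Path.nil : Path a a) p (Path.nil_comp p).symm x).2 = x
  prod_nil : ∀ {a b : V} (p : Path a b) (x : obj p),
    (prod p (Path.nil : Path b b) (Path.comp_nil p).symm x).1 = x

/-- A 2-functor from the free 2-category on `P` to `Ord`. -/
structure OrdFunctor {V : Type u} [Quiver.{v} V] (P : TwoPolygraph.{u, v, w} V) extends
    OrdFamily.{u, v, x} V where
  map : {a b : V} → {p q : Path a b} → Cell P p q → obj p →o obj q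
  map_id : ∀ {a b : V} (p : Path a b) (x : obj p), map (Cell.id p) x = x
  map_vcomp : ∀ {a b : V} {p q r : Path a b} (g : Cell P p q) (h : Cell P q r) (x : obj p),
    map (g.vcomp h) x = map h (map g x)
  map_hcomp : ∀ {a b c : V} {p q : Path a b} {p' q' : Path b c} (g : Cell P p q)
    (h : Cell P p' q') (x : obj (p.comp p')),
    prod q q' rfl (map (g.hcomp h) x) =
      (map g (prod p p' rfl x).1, map h (prod p p' rfl x).2)

/-- A 2-functor to `Ord` from the free 2-category on `P` with its 2-cells reversed. -/
structure OrdCofunctor {V : Type u} [Quiver.{v} V] (P : TwoPolygraph.{u, v, w} V) extends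
    OrdFamily.{u, v, x} V where
  map : {a b : V} → {p q : Path a b} → Cell P p q → obj q →o obj p
  map_id : ∀ {a b : V} (p : Path a b) (y : obj p), map (Cell.id p) y = y
  map_vcomp : ∀ {a b : V} {p q r : Path a b} (g : Cell P p q) (h : Cell P q r) (y : obj r),
    map (g.vcomp h) y = map g (map h y)
  map_hcomp : ∀ {a b c : V} {p q : Path a b} {p' q' : Path b c} (g : Cell P p q)
    (h : Cell P p' q') (y : obj (q.comp q')),
    prod p p' rfl (map (g.hcomp h) y) =
      (map g (prod q q' rfl y).1, map h (prod q q' rfl y).2)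

/-! ### The module of a pair of 2-functors, and derivations -/

/-- Contexts of the free 2-category: 2-cells with one hole of boundary `(p, q)`, built from the hole
by whiskering and by vertical composition on both sides. -/
inductive Context {V : Type u} [Quiver.{v} V] (P : TwoPolygraph.{u, v, w} V) {a b : V}
    (p q : Path a b) : {a' b' : V} → Path a' b' → Path a' b' → Type (max u v w)
  | hole : Context P p q p q
  | whiskerLeft {a'' a' b' : V} {p' q' : Path a' b'} (f : Path a'' a')
      (c : Context P p q p' q') : Context P p q (f.comp p') (f.comp q')
  | whiskerRight {a' b' b'' : V} {p' q' : Path a' b'} (c : Context P p q p' q')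
      (g : Path b' b'') : Context P p q (p'.comp g) (q'.comp g)
  | vcomp {a' b' : V} {p'' p' q' q'' : Path a' b'} (m : Cell P p'' p')
      (c : Context P p q p' q') (n : Cell P q' q'') : Context P p q p'' q''

namespace Context

variable {V : Type u} [Quiver.{v} V] {P : TwoPolygraph.{u, v, w} V}

/-- The context `g ⋆₁ S`, where `S` has boundary `(q, r)`. -/
def leftV {a b : V} {p q : Path a b} (g : Cell P p q) (r : Path a b) : Context P q r p r :=
  .vcomp g .hole (Cell.id r)

/-- The context `S ⋆₁ h`, where `S` has boundary `(p, q)`. -/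
def rightV {a b : V} {q r : Path a b} (p : Path a b) (h : Cell P q r) : Context P p q p r :=
  .vcomp (Cell.id p) .hole h

/-- The context `g ⋆₀ S = (g ⋆₀ p') ⋆₁ (q ⋆₀ S)`, where `S` has boundary `(p', q')`. -/
def leftH {a b c : V} {p q : Path a b} (g : Cell P p q) (p' q' : Path b c) :
    Context P p' q' (p.comp p') (q.comp q') :=
  .vcomp (g.hcomp (Cell.id p')) (.whiskerLeft q .hole) (Cell.id (q.comp q'))

/-- The context `S ⋆₀ h = (p ⋆₀ h) ⋆₁ (S ⋆₀ q')`, where `S` has boundary `(p, q)`. -/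
def rightH {a b c : V} {p' q' : Path b c} (p q : Path a b) (h : Cell P p' q') :
    Context P p q (p.comp p') (q.comp q') :=
  .vcomp ((Cell.id p).hcomp h) (.whiskerRight .hole q') (Cell.id (q.comp q'))

end Context

/-- The value of the module `M_{X,Y,G}` at a 2-cell `p ⇒ q`: monotone maps `X(p) × Y(q) → G`. -/
abbrev ModuleObj {V : Type u} [Quiver.{v} V] {P : TwoPolygraph.{u, v, w} V} (X : OrdFunctor P)
    (Y : OrdCofunctor P) (G : Type*) [PartialOrder G] {a b : V} (p q : Path a b) :=
  X.obj p × Y.obj q →o G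

/-- The action of the module `M_{X,Y,G}` on contexts. -/
def moduleMap {V : Type u} [Quiver.{v} V] {P : TwoPolygraph.{u, v, w} V} (X : OrdFunctor P)
    (Y : OrdCofunctor P) {G : Type*} [PartialOrder G] {a b : V} {p q : Path a b} :
    {a' b' : V} → {p' q' : Path a' b'} → Context P p q p' q' →
      ModuleObj X Y G p q → ModuleObj X Y G p' q'
  | _, _, _, _, .hole, m => m
  | _, _, _, _, .whiskerLeft (p' := p') (q' := q') f c, m =>
      { toFun := fun z => moduleMap X Y c m ((X.prod f p' rfl z.1).2, (Y.prod f q' rfl z.2).2)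
        monotone' := fun _ _ h => (moduleMap X Y c m).monotone
          ⟨((X.prod f p' rfl).monotone h.1).2, ((Y.prod f q' rfl).monotone h.2).2⟩ }
  | _, _, _, _, .whiskerRight (p' := p') (q' := q') c g, m =>
      { toFun := fun z => moduleMap X Y c m ((X.prod p' g rfl z.1).1, (Y.prod q' g rfl z.2).1)
        monotone' := fun _ _ h => (moduleMap X Y c m).monotone
          ⟨((X.prod p' g rfl).monotone h.1).1, ((Y.prod q' g rfl).monotone h.2).1⟩ }
  | _, _, _, _, .vcomp g c h, m =>
      { toFun := fun z => moduleMap X Y c m (X.map g z.1, Y.map h z.2)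
        monotone' := fun _ _ hz => (moduleMap X Y c m).monotone
          ⟨(X.map g).monotone hz.1, (Y.map h).monotone hz.2⟩ }

/-- A derivation of the free 2-category on `P` into the module `M_{X,Y,G}`:
`d(g ⋆ᵢ h) = g ⋆ᵢ d(h) + d(g) ⋆ᵢ h` for `i = 0, 1`, where the sum is taken pointwise. -/
structure ModuleDerivation {V : Type u} [Quiver.{v} V] {P : TwoPolygraph.{u, v, w} V}
    (X : OrdFunctor P) (Y : OrdCofunctor P) (G : Type*) [AddCommGroup G] [PartialOrder G] where
  d : {a b : V} → {p q : Path a b} → Cell P p q → ModuleObj X Y G p q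
  d_vcomp : ∀ {a b : V} {p q r : Path a b} (g : Cell P p q) (h : Cell P q r)
    (z : X.obj p × Y.obj r),
    d (g.vcomp h) z =
      moduleMap X Y (Context.leftV g r) (d h) z + moduleMap X Y (Context.rightV p h) (d g) z
  d_hcomp : ∀ {a b c : V} {p q : Path a b} {p' q' : Path b c} (g : Cell P p q)
    (h : Cell P p' q') (z : X.obj (p.comp p') × Y.obj (q.comp q')),
    d (g.hcomp h) z =
      moduleMap X Y (Context.leftH g p' q') (d h) z +
        moduleMap X Y (Context.rightH p q h) (d g) z

end SuperRewriting

namespace SuperRewriting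

open Quiver (Path)

section

variable {V : Type*} [Quiver V]

/-! ### Comparison of the two congruences on formal composites -/

/-! The free 2-supercategory is graded by the 2-cells of the free 2-category. Every imposed relation
`D = ±D'` links composites with the same underlying 2-cell (`SExch.exch`), so the projections
`SCell.proj` are well defined; conversely two composites with the same underlying 2-cell agree up to
sign (`Exch.exists_sExch`), so each component is spanned by any of its representatives, possibly
zero. Hence the support is the finite set of indices of nonzero components (`SCell.mem_supp_iff`),
whichever decomposition is used.

A rewriting step then removes the 2-cell `g` of the plugged source from the support, and every new
element is the plugging of an element of the support of the target into the same context
(`RewritingStep.exists_supp`).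

Fix a point `(x, y)` of `X(p) × Y(q)`, where `p ⇒ q` is the boundary of the sequence, and weigh a
2-cell `h` by `d(h)(x, y)`. The derivation rule and monotonicity carry the strict inequality between
source and target through every context (`d_plug_lt`), so new elements weigh less than `g`.
Comparison of weights is well founded because weights are non-negative. Replacing one element of a
finite multiset by finitely many smaller ones is then well founded too, which excludes infinite
sequences (`not_exists_seq_of_supp`). -/

theorem SExch.exch {P : TwoSuperpolygraph V} {ε : ℤˣ} {a b : V} {p q : Path a b}
    {D D' : Past P.toTwoPolygraph p q} (h : SExch P ε D D') :
    Exch P.toTwoPolygraph D D' := by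
  induction h with
  | refl D => exact .refl D
  | symm _ ih => exact ih.symm
  | trans _ _ ih ih' => exact ih.trans ih'
  | vcomp_congr _ _ ih ih' => exact .vcomp_congr ih ih'
  | hcomp_congr hs ht _ _ ih ih' => exact .hcomp_congr hs ht ih ih'
  | vassoc D E F => exact .vassoc D E F
  | id_vcomp D => exact .id_vcomp D
  | vcomp_id D => exact .vcomp_id D
  | hassoc D E F => exact .hassoc D E F
  | id_hcomp D => exact .id_hcomp D
  | hcomp_id D => exact .hcomp_id D
  | id_hcomp_id p p' => exact .id_hcomp_id p p'
  | superinterchange D E D' E' => exact .exchange D E D' E'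

/-- Each axiom of a 2-category is a super axiom up to sign, and only exchange brings in a sign. The
sign need not be unique: a composite related to itself by `-1` satisfies `2D = 0` in the quotient.
-/
theorem Exch.exists_sExch {P : TwoSuperpolygraph V} {a b : V} {p q : Path a b}
    {D D' : Past P.toTwoPolygraph p q} (h : Exch P.toTwoPolygraph D D') :
    ∃ ε, SExch P ε D D' := by
  induction h with
  | refl D => exact ⟨_, .refl D⟩
  | symm _ ih => exact ih.imp fun _ h => h.symm
  | trans _ _ ih ih' =>
    obtain ⟨_, h⟩ := ih
    obtain ⟨_, h'⟩ := ih'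
    exact ⟨_, h.trans h'⟩
  | vcomp_congr _ _ ih ih' =>
    obtain ⟨_, h⟩ := ih
    obtain ⟨_, h'⟩ := ih'
    exact ⟨_, .vcomp_congr h h'⟩
  | hcomp_congr hs ht _ _ ih ih' =>
    obtain ⟨_, h⟩ := ih
    obtain ⟨_, h'⟩ := ih'
    exact ⟨_, .hcomp_congr hs ht h h'⟩
  | vassoc D E F => exact ⟨_, .vassoc D E F⟩
  | id_vcomp D => exact ⟨_, .id_vcomp D⟩
  | vcomp_id D => exact ⟨_, .vcomp_id D⟩
  | hassoc D E F => exact ⟨_, .hassoc D E F⟩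
  | id_hcomp D => exact ⟨_, .id_hcomp D⟩
  | hcomp_id D => exact ⟨_, .hcomp_id D⟩
  | id_hcomp_id p p' => exact ⟨_, .id_hcomp_id p p'⟩
  | exchange D E D' E' => exact ⟨_, .superinterchange D E D' E'⟩

/-! ### The grading of the free 2-supercategory by the free 2-category -/

namespace SCell

variable {P : TwoSuperpolygraph V} {𝕜 : Type*} [Field 𝕜] {a b : V} {p q : Path a b}

/-- A 2-cell is a linear combination of formal composites. -/
theorem exists_eq_sum (z : SCell P 𝕜 p q) :
    ∃ c : Past P.toTwoPolygraph p q →₀ 𝕜, z = c.sum fun D k => k • ofPast 𝕜 D := by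
  obtain ⟨c, rfl⟩ := (relations P 𝕜 p q).mkQ_surjective z
  refine ⟨c, ?_⟩
  conv_lhs => rw [← c.sum_single]
  rw [map_finsuppSum]
  refine Finsupp.sum_congr fun D _ => ?_
  rw [ofPast, ← map_smul, Finsupp.smul_single, smul_eq_mul, mul_one]

open Classical in
/-- The projection to the component indexed by a 2-cell of the free 2-category. -/
noncomputable def proj (h : Cell P.toTwoPolygraph p q) :
    SCell P 𝕜 p q →ₗ[𝕜] SCell P 𝕜 p q :=
  lift (fun D => if Cell.mk D = h then ofPast 𝕜 D else 0) (by
    intro ε D D' hD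
    have : (Cell.mk D : Cell P.toTwoPolygraph p q) = Cell.mk D' := Quotient.sound hD.exch
    simp only [this]
    split_ifs
    · exact ofPast_eq hD
    · rw [smul_zero])

open Classical in
theorem proj_ofPast (h : Cell P.toTwoPolygraph p q) (D : Past P.toTwoPolygraph p q) :
    proj h (ofPast 𝕜 D) = if Cell.mk D = h then ofPast 𝕜 D else 0 :=
  lift_ofPast _ _ _

open Classical in
theorem proj_sum (h : Cell P.toTwoPolygraph p q) (c : Past P.toTwoPolygraph p q →₀ 𝕜) :
    proj h (c.sum fun D k => k • ofPast 𝕜 D) =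
      c.sum fun D k => if Cell.mk D = h then k • ofPast 𝕜 D else 0 := by
  rw [map_finsuppSum]
  refine Finsupp.sum_congr fun D _ => ?_
  rw [map_smul, proj_ofPast, smul_ite, smul_zero]

/-- The components of a 2-cell are one-dimensional. -/
theorem exists_proj_eq_smul (D : Past P.toTwoPolygraph p q) (z : SCell P 𝕜 p q) :
    ∃ k : 𝕜, proj (Cell.mk D) z = k • ofPast 𝕜 D := by
  classical
  obtain ⟨c, rfl⟩ := exists_eq_sum z
  suffices H : proj (Cell.mk D) (c.sum fun D k => k • ofPast 𝕜 D) ∈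
      Submodule.span 𝕜 {ofPast 𝕜 D} by
    obtain ⟨k, hk⟩ := Submodule.mem_span_singleton.1 H
    exact ⟨k, hk.symm⟩
  rw [proj_sum]
  refine Submodule.sum_mem _ fun E _ => ?_
  dsimp only
  split_ifs with hE
  -- Terms with the same underlying 2-cell as `D` are `±D`; all the others are killed by the
  -- projection.
  · obtain ⟨ε, hε⟩ := (Quotient.exact hE : Exch _ E D).exists_sExch
    rw [ofPast_eq hε]
    exact Submodule.smul_mem _ _ (Submodule.smul_mem _ _ (Submodule.mem_span_singleton_self _))
  · exact Submodule.zero_mem _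

theorem finite_proj_ne_zero (z : SCell P 𝕜 p q) :
    {h : Cell P.toTwoPolygraph p q | proj h z ≠ 0}.Finite := by
  classical
  obtain ⟨c, rfl⟩ := exists_eq_sum z
  refine (c.support.image Cell.mk).finite_toSet.subset fun h hh => ?_
  by_contra hc
  refine hh ?_
  rw [proj_sum]
  refine Finset.sum_eq_zero fun D hD => if_neg ?_
  rintro rfl
  exact hc (Finset.mem_coe.2 (Finset.mem_image_of_mem _ hD))

/-- A 2-cell is the sum of its components. -/
theorem sum_proj (z : SCell P 𝕜 p q) (S : Finset (Cell P.toTwoPolygraph p q))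
    (hS : ∀ h, proj h z ≠ 0 → h ∈ S) : ∑ h ∈ S, proj h z = z := by
  classical
  have key : ∀ T : Finset (Cell P.toTwoPolygraph p q), S ⊆ T →
      ∑ h ∈ S, proj h z = ∑ h ∈ T, proj h z := fun T hT =>
    Finset.sum_subset hT fun h _ hn => by_contra fun hc => hn (hS h hc)
  obtain ⟨c, hc⟩ := exists_eq_sum z
  -- Enlarging the index set to contain the underlying 2-cell of every term of `c` makes each term
  -- survive in exactly one projection once the sums are swapped.
  rw [key (S ∪ c.support.image Cell.mk) Finset.subset_union_left]
  conv_rhs => rw [hc]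
  conv_lhs => rw [hc]
  simp only [proj_sum]
  simp only [Finsupp.sum]
  rw [Finset.sum_comm]
  refine Finset.sum_congr rfl fun D hD => ?_
  rw [Finset.sum_ite_eq, if_pos (Finset.mem_union_right _ (Finset.mem_image_of_mem _ hD))]

/-- The support consists of the indices of the nonzero components. -/
theorem mem_supp_iff {z : SCell P 𝕜 p q} {h : Cell P.toTwoPolygraph p q} :
    h ∈ Supp z ↔ proj h z ≠ 0 := by
  classical
  constructor
  · rintro ⟨c, ⟨hmon, hinj, rfl⟩, D, hD, rfl⟩
    -- Distinctness of the underlying 2-cells leaves a single term in this component, so nothing can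
    -- cancel it.
    rw [proj_sum, Finsupp.sum, Finset.sum_eq_single D, if_pos rfl]
    · exact smul_ne_zero (Finsupp.mem_support_iff.1 hD) (hmon D hD).1
    · exact fun E hE hne => if_neg fun he => hne (hinj hE hD he)
    · exact fun hn => absurd hD hn
  · intro hh
    -- A decomposition is built from one chosen representative per 2-cell, keeping only the nonzero
    -- components so that each representative is a monomial.
    have hrep : ∀ g : Cell P.toTwoPolygraph p q, ∃ D, Cell.mk D = g := Quotient.exists_rep
    choose rep hrep using hrep
    have hk : ∀ g, ∃ k : 𝕜, proj g z = k • ofPast 𝕜 (rep g) := fun g => by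
      simpa only [hrep] using exists_proj_eq_smul (rep g) z
    choose k hk using hk
    have hinj : Function.Injective rep := fun g g' e => by rw [← hrep g, e, hrep g']
    let S := (finite_proj_ne_zero z).toFinset
    have hS : ∀ g, g ∈ S ↔ proj g z ≠ 0 := fun g => by simp [S]
    let c : Past P.toTwoPolygraph p q →₀ 𝕜 := ∑ g ∈ S, Finsupp.single (rep g) (k g)
    have hc : ∀ g ∈ S, c (rep g) = k g := by
      intro g hg
      simp only [c, Finsupp.finsetSum_apply]
      rw [Finset.sum_eq_single g, Finsupp.single_eq_same]
      · exact fun g' _ hne => Finsupp.single_eq_of_ne fun e => hne (hinj e).symm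
      · exact fun hn => absurd hg hn
    have hsupp : ∀ D ∈ c.support, ∃ g ∈ S, rep g = D := by
      intro D hD
      obtain ⟨g, hg, hgD⟩ := Finset.mem_biUnion.1 (Finsupp.support_finsetSum hD)
      exact ⟨g, hg, (Finset.mem_singleton.1 (Finsupp.support_single_subset hgD)).symm⟩
    refine ⟨c, ⟨?_, ?_, ?_⟩, rep h, ?_, hrep h⟩
    · intro D hD
      obtain ⟨g, hg, rfl⟩ := hsupp D hD
      refine ⟨fun h0 => (hS g).1 hg ?_, _, rfl⟩
      rw [hk, h0, smul_zero]
    · intro D hD E hE he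
      obtain ⟨g, -, rfl⟩ := hsupp D hD
      obtain ⟨g', -, rfl⟩ := hsupp E hE
      rw [hrep, hrep] at he
      rw [he]
    · rw [← Finsupp.sum_finsetSum_index (h := fun D k => k • ofPast 𝕜 D)
        (fun _ => zero_smul _ _) (fun _ _ _ => add_smul _ _ _)]
      conv_lhs => rw [← sum_proj z S fun g => (hS g).2]
      refine Finset.sum_congr rfl fun g _ => ?_
      rw [Finsupp.sum_single_index (h := fun D k => k • ofPast 𝕜 D) (zero_smul _ _), hk]
    · rw [Finsupp.mem_support_iff, hc h ((hS h).2 hh)]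
      intro h0
      exact hh (by rw [hk, h0, zero_smul])

theorem finite_supp (z : SCell P 𝕜 p q) : (Supp z).Finite :=
  (finite_proj_ne_zero z).subset fun _ => mem_supp_iff.1

theorem mem_supp_ofPast {D : Past P.toTwoPolygraph p q} (hD : ofPast 𝕜 D ≠ 0)
    {h : Cell P.toTwoPolygraph p q} : h ∈ Supp (ofPast 𝕜 D) ↔ h = Cell.mk D := by
  classical
  rw [mem_supp_iff, proj_ofPast, ne_eq, ite_eq_right_iff, Classical.not_imp]
  exact ⟨fun H => H.1.symm, fun H => ⟨H.symm, hD⟩⟩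

theorem vcomp_ofPast {r : Path a b} (D : Past P.toTwoPolygraph p q)
    (E : Past P.toTwoPolygraph q r) :
    vcomp (ofPast 𝕜 D) (ofPast 𝕜 E) = ofPast 𝕜 (D.vcomp E) := by
  rw [vcomp, lift_ofPast, lift_ofPast]

theorem hcomp_ofPast {c : V} {p' q' : Path b c} (D : Past P.toTwoPolygraph p q)
    (E : Past P.toTwoPolygraph p' q') :
    hcomp (ofPast 𝕜 D) (ofPast 𝕜 E) = ofPast 𝕜 (D.hcomp E rfl rfl) := by
  rw [hcomp, lift_ofPast, lift_ofPast]

/-- The support of the image of `z` under a linear map sending formal composites to formal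
composites consists of images of elements of the support of `z`. -/
theorem supp_map_subset {a' b' : V} {p' q' : Path a' b'}
    (F : SCell P 𝕜 p q →ₗ[𝕜] SCell P 𝕜 p' q')
    (φ : Past P.toTwoPolygraph p q → Past P.toTwoPolygraph p' q')
    (hF : ∀ D, F (ofPast 𝕜 D) = ofPast 𝕜 (φ D)) (z : SCell P 𝕜 p q)
    {h : Cell P.toTwoPolygraph p' q'} (hh : h ∈ Supp (F z)) :
    ∃ D, Cell.mk D ∈ Supp z ∧ h = Cell.mk (φ D) := by
  classical
  rw [mem_supp_iff] at hh
  rw [← sum_proj z (finite_supp z).toFinset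
    fun g hg => (finite_supp z).mem_toFinset.2 (mem_supp_iff.2 hg), map_sum, map_sum] at hh
  obtain ⟨g, hg, hne⟩ := Finset.exists_ne_zero_of_sum_ne_zero hh
  obtain ⟨D, rfl⟩ : ∃ D, Cell.mk D = g := Quotient.exists_rep g
  refine ⟨D, (finite_supp z).mem_toFinset.1 hg, ?_⟩
  -- The component at `D` is a multiple of `D`, so its image is a multiple of `φ D` and lives in one
  -- component only.
  obtain ⟨k, hk⟩ := exists_proj_eq_smul D z
  rw [hk, map_smul, map_smul, hF, proj_ofPast] at hne
  by_contra hc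
  rw [if_neg fun e => hc e.symm, smul_zero] at hne
  exact hne rfl

end SCell

/-! ### Contexts and formal composites -/

/-- The formal composite `M₁ ⋆₁ (M₂ ⋆₀ D ⋆₀ M₃) ⋆₁ M₄`. -/
def Past.plug {P : TwoPolygraph V} {a b a' b' : V} {p q : Path a b} {p' q' : Path a' b'}
    {f f' : Path a' a} {g g' : Path b b'} (M₁ : Past P p' (f.comp (p.comp g))) (M₂ : Past P f f')
    (M₃ : Past P g g') (M₄ : Past P (f'.comp (q.comp g')) q') (D : Past P p q) : Past P p' q' :=
  M₁.vcomp ((M₂.hcomp (D.hcomp M₃ rfl rfl) rfl rfl).vcomp M₄)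

/-- The 2-cell `m₁ ⋆₁ (m₂ ⋆₀ u ⋆₀ m₃) ⋆₁ m₄`. -/
def Cell.plug {P : TwoPolygraph V} {a b a' b' : V} {p q : Path a b} {p' q' : Path a' b'}
    {f f' : Path a' a} {g g' : Path b b'} (m₁ : Cell P p' (f.comp (p.comp g))) (m₂ : Cell P f f')
    (m₃ : Cell P g g') (m₄ : Cell P (f'.comp (q.comp g')) q') (u : Cell P p q) : Cell P p' q' :=
  m₁.vcomp ((m₂.hcomp (u.hcomp m₃)).vcomp m₄)

theorem SuperContext.plug_ofPast {P : TwoSuperpolygraph V} {𝕜 : Type*} [Field 𝕜] {a b a' b' : V}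
    {p q : Path a b} {p' q' : Path a' b'} (c : SuperContext P 𝕜 p q p' q')
    {M₁ : Past P.toTwoPolygraph p' (c.f.comp (p.comp c.g))} {M₂ : Past P.toTwoPolygraph c.f c.f'}
    {M₃ : Past P.toTwoPolygraph c.g c.g'}
    {M₄ : Past P.toTwoPolygraph (c.f'.comp (q.comp c.g')) q'}
    (h₁ : c.m₁ = SCell.ofPast 𝕜 M₁) (h₂ : c.m₂ = SCell.ofPast 𝕜 M₂)
    (h₃ : c.m₃ = SCell.ofPast 𝕜 M₃) (h₄ : c.m₄ = SCell.ofPast 𝕜 M₄)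
    (D : Past P.toTwoPolygraph p q) :
    c.plug (SCell.ofPast 𝕜 D) = SCell.ofPast 𝕜 (Past.plug M₁ M₂ M₃ M₄ D) := by
  rw [SuperContext.plug, h₁, h₂, h₃, h₄, SCell.hcomp_ofPast, SCell.hcomp_ofPast,
    SCell.vcomp_ofPast, SCell.vcomp_ofPast, Past.plug]

/-- Plugging into a context is linear. -/
theorem SuperContext.exists_linearMap_eq_plug {P : TwoSuperpolygraph V} {𝕜 : Type*} [Field 𝕜]
    {a b a' b' : V} {p q : Path a b} {p' q' : Path a' b'} (c : SuperContext P 𝕜 p q p' q') :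
    ∃ F : SCell P 𝕜 p q →ₗ[𝕜] SCell P 𝕜 p' q', ∀ z, F z = c.plug z :=
  ⟨SCell.vcomp c.m₁ ∘ₗ SCell.vcomp.flip c.m₄ ∘ₗ SCell.hcomp c.m₂ ∘ₗ SCell.hcomp.flip c.m₃,
    fun _ => rfl⟩

/-! ### Ordered families and derivations -/

/-- Identity paths give a point and composites give products, so generating 1-cells suffice. -/
theorem OrdFamily.nonempty_obj (X : OrdFamily V)
    (hX : ∀ {a b : V} (e : a ⟶ b), Nonempty (X.obj e.toPath)) {a b : V} (p : Path a b) :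
    Nonempty (X.obj p) := by
  induction p with
  | nil => exact ⟨(X.unit a).symm PUnit.unit⟩
  | cons p e ih =>
    obtain ⟨x⟩ := ih
    obtain ⟨y⟩ := hX e
    exact ⟨(X.prod p e.toPath rfl).symm (x, y)⟩

section Derivation

variable {P : TwoPolygraph V} {X : OrdFunctor P} {Y : OrdCofunctor P}

/-- `X.prod` is an order isomorphism, so the comparison is made on each factor. -/
theorem OrdFunctor.map_hcomp_le {a b c : V} {p q : Path a b} {p' q' : Path b c}
    {u v : Cell P p q} {u' v' : Cell P p' q'} (h : ∀ x, X.map u x ≤ X.map v x)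
    (h' : ∀ x, X.map u' x ≤ X.map v' x) (x : X.obj (p.comp p')) :
    X.map (u.hcomp u') x ≤ X.map (v.hcomp v') x := by
  rw [← (X.prod q q' rfl).le_iff_le, X.map_hcomp, X.map_hcomp]
  exact ⟨h _, h' _⟩

theorem OrdCofunctor.map_hcomp_le {a b c : V} {p q : Path a b} {p' q' : Path b c}
    {u v : Cell P p q} {u' v' : Cell P p' q'} (h : ∀ y, Y.map u y ≤ Y.map v y)
    (h' : ∀ y, Y.map u' y ≤ Y.map v' y) (y : Y.obj (q.comp q')) :
    Y.map (u.hcomp u') y ≤ Y.map (v.hcomp v') y := by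
  rw [← (Y.prod p p' rfl).le_iff_le, Y.map_hcomp, Y.map_hcomp]
  exact ⟨h _, h' _⟩

namespace ModuleDerivation

variable {G : Type*} [AddCommGroup G] [PartialOrder G]

theorem d_vcomp_apply (D : ModuleDerivation X Y G) {a b : V} {p q r : Path a b} (g : Cell P p q)
    (h : Cell P q r) (x : X.obj p) (y : Y.obj r) :
    D.d (g.vcomp h) (x, y) = D.d h (X.map g x, y) + D.d g (x, Y.map h y) := by
  rw [D.d_vcomp]
  change D.d h (X.map g x, Y.map (Cell.id r) y) + D.d g (X.map (Cell.id p) x, Y.map h y) = _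
  rw [X.map_id, Y.map_id]

/-- The contexts `leftH` and `rightH` push `X` through the other factor, but the projection then
selects the coordinate on which an identity acts; this is why no value of `X` or `Y` on `g` or `h`
remains. -/
theorem d_hcomp_apply (D : ModuleDerivation X Y G) {a b c : V} {p q : Path a b}
    {p' q' : Path b c} (g : Cell P p q) (h : Cell P p' q') (x : X.obj (p.comp p'))
    (y : Y.obj (q.comp q')) :
    D.d (g.hcomp h) (x, y) =
      D.d h ((X.prod p p' rfl x).2, (Y.prod q q' rfl y).2) +
        D.d g ((X.prod p p' rfl x).1, (Y.prod q q' rfl y).1) := by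
  rw [D.d_hcomp]
  change D.d h ((X.prod q p' rfl (X.map (g.hcomp (Cell.id p')) x)).2,
      (Y.prod q q' rfl (Y.map (Cell.id (q.comp q')) y)).2) +
    D.d g ((X.prod p q' rfl (X.map ((Cell.id p).hcomp h) x)).1,
      (Y.prod q q' rfl (Y.map (Cell.id (q.comp q')) y)).1) = _
  rw [X.map_hcomp, X.map_hcomp, X.map_id, X.map_id, Y.map_id]

/-- The strict comparison of 2-cells by `X`, `Y` and a derivation is compatible with contexts. -/
theorem d_plug_lt [IsOrderedAddMonoid G] (D : ModuleDerivation X Y G) {a b a' b' : V}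
    {p q : Path a b} {p' q' : Path a' b'} {f f' : Path a' a} {g g' : Path b b'}
    (m₁ : Cell P p' (f.comp (p.comp g))) (m₂ : Cell P f f') (m₃ : Cell P g g')
    (m₄ : Cell P (f'.comp (q.comp g')) q') {u v : Cell P p q}
    (hX : ∀ x, X.map u x ≤ X.map v x) (hY : ∀ y, Y.map u y ≤ Y.map v y)
    (hd : ∀ z, D.d u z < D.d v z) (x : X.obj p') (y : Y.obj q') :
    D.d (Cell.plug m₁ m₂ m₃ m₄ u) (x, y) < D.d (Cell.plug m₁ m₂ m₃ m₄ v) (x, y) := by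
  simp only [Cell.plug, d_vcomp_apply, d_hcomp_apply]
  -- Five contributions: those of `m₂` and `m₃` do not depend on the plugged cell, that of the cell
  -- itself drops strictly, and those of `m₄` and `m₁` see it only through `X` and `Y` respectively,
  -- so they vary weakly by monotonicity.
  refine add_lt_add_of_lt_of_le (add_lt_add_of_le_of_lt ((D.d m₄).monotone ⟨?_, le_rfl⟩)
    (add_lt_add_left (add_lt_add_right (hd _) _) _)) ((D.d m₁).monotone ⟨le_rfl, ?_⟩)
  · exact X.map_hcomp_le (fun _ => le_rfl) (X.map_hcomp_le hX fun _ => le_rfl) _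
  · change Y.map _ y ≤ Y.map _ y
    rw [Y.map_vcomp, Y.map_vcomp]
    exact Y.map_hcomp_le (fun _ => le_rfl) (Y.map_hcomp_le hY fun _ => le_rfl) _

end ModuleDerivation

end Derivation

/-- A function with non-negative values in an ordered group where decreasing non-negative sequences
are stationary induces a well-founded relation. -/
theorem wellFounded_lt_of_stationary {ι G : Type*} [Zero G] [PartialOrder G]
    (hG : ∀ s : ℕ → G, Antitone s → (∀ n, 0 ≤ s n) → ∃ N, ∀ n, N ≤ n → s n = s N)
    (w : ι → G) (hw : ∀ i, 0 ≤ w i) : WellFounded fun i j => w i < w j := by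
  rw [wellFounded_iff_isEmpty_descending_chain]
  refine ⟨fun ⟨s, hs⟩ => ?_⟩
  obtain ⟨N, hN⟩ := hG (fun n => w (s n)) (antitone_nat_of_succ_le fun n => (hs n).le)
    fun n => hw _
  exact (hs N).ne (hN (N + 1) N.le_succ)

/-! ### The effect of a rewriting step on supports -/

/-- Here `g` is the 2-cell of the plugged source. Only inclusions are claimed for the new support,
since terms of the plugged target may cancel against the rest. -/
theorem ThreeTwoSuperpolygraph.RewritingStep.exists_supp {𝕜 : Type*} [Field 𝕜]
    {P : ThreeTwoSuperpolygraph V 𝕜} (hP : P.LeftMonomial) {a' b' : V} {p' q' : Path a' b'}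
    {x y : SCell P.toTwoSuperpolygraph 𝕜 p' q'} (h : P.RewritingStep x y)
    (r : Cell P.U p' q' → Cell P.U p' q' → Prop)
    (hr : ∀ {a b : V} {p q : Path a b} (α : P.Gen₃ p q), ∀ u ∈ (P.tgt α).Supp,
      ∀ v ∈ (P.src α).Supp, ∀ {f f' : Path a' a} {g g' : Path b b'}
        (m₁ : Cell P.U p' (f.comp (p.comp g))) (m₂ : Cell P.U f f') (m₃ : Cell P.U g g')
        (m₄ : Cell P.U (f'.comp (q.comp g')) q'),
        r (Cell.plug m₁ m₂ m₃ m₄ u) (Cell.plug m₁ m₂ m₃ m₄ v)) :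
    ∃ g ∈ x.Supp, ∀ h ∈ y.Supp, h ∈ x.Supp ∧ h ≠ g ∨ r h g := by
  obtain ⟨a, b, p, q, α, c, hmon, hdisj, rfl, rfl⟩ := h
  obtain ⟨hS0, S, hS⟩ := hP α
  obtain ⟨-, M₁, h₁⟩ := c.isMonomial₁
  obtain ⟨-, M₂, h₂⟩ := c.isMonomial₂
  obtain ⟨-, M₃, h₃⟩ := c.isMonomial₃
  obtain ⟨-, M₄, h₄⟩ := c.isMonomial₄
  have hplug := c.plug_ofPast h₁ h₂ h₃ h₄
  have hsrc : c.plug (P.src α) = SCell.ofPast 𝕜 (Past.plug M₁ M₂ M₃ M₄ S) := by rw [hS, hplug]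
  have hne : SCell.ofPast 𝕜 (Past.plug M₁ M₂ M₃ M₄ S) ≠ 0 := hsrc ▸ hmon.1
  have hsupp : ∀ g, g ∈ (c.plug (P.src α)).Supp ↔ g = Cell.mk (Past.plug M₁ M₂ M₃ M₄ S) := by
    intro g
    rw [hsrc, SCell.mem_supp_ofPast hne]
  -- Disjointness prevents the rest from contributing at `g`: it neither cancels the redex in `x`
  -- nor keeps `g` alive in `y`.
  have hrest : SCell.proj (Cell.mk (Past.plug M₁ M₂ M₃ M₄ S)) c.rest = 0 := by
    by_contra hc
    exact Set.disjoint_left.1 hdisj ((hsupp _).2 rfl) (SCell.mem_supp_iff.2 hc)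
  refine ⟨Cell.mk (Past.plug M₁ M₂ M₃ M₄ S), ?_, fun h hh => ?_⟩
  · rw [SCell.mem_supp_iff, SuperContext.fill, map_add, hrest, add_zero, map_smul]
    exact smul_ne_zero c.scalar_ne (SCell.mem_supp_iff.1 ((hsupp _).2 rfl))
  · by_cases ht : h ∈ (c.plug (P.tgt α)).Supp
    · right
      obtain ⟨F, hF⟩ := c.exists_linearMap_eq_plug
      obtain ⟨D, hD, rfl⟩ := SCell.supp_map_subset F (Past.plug M₁ M₂ M₃ M₄)
        (fun D => (hF _).trans (hplug D)) (P.tgt α) (by rwa [hF])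
      refine hr α (Cell.mk D) hD (Cell.mk S) ?_ (Cell.mk M₁) (Cell.mk M₂) (Cell.mk M₃)
        (Cell.mk M₄)
      rw [hS, SCell.mem_supp_ofPast (hS ▸ hS0)]
    · left
      rw [SCell.mem_supp_iff, not_not] at ht
      rw [SCell.mem_supp_iff, SuperContext.fill, map_add, map_smul, ht, smul_zero, zero_add] at hh
      have hg : h ≠ Cell.mk (Past.plug M₁ M₂ M₃ M₄ S) := fun e => hh (e ▸ hrest)
      refine ⟨?_, hg⟩
      -- Away from `g` the plugged source has no component, so `x` and the rest agree at `h`.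
      have hs : SCell.proj h (c.plug (P.src α)) = 0 := by
        by_contra hc
        exact hg ((hsupp h).1 (SCell.mem_supp_iff.2 hc))
      rwa [SCell.mem_supp_iff, SuperContext.fill, map_add, map_smul, hs, smul_zero, zero_add]

/-- If each step replaces an element of a finite support by smaller ones for a well-founded
relation, then there is no infinite sequence of steps. -/
theorem not_exists_seq_of_supp {A ι : Type*} {step : A → A → Prop} {supp : A → Set ι}
    (hfin : ∀ x, (supp x).Finite) {r : ι → ι → Prop} (hr : WellFounded r)
    (hstep : ∀ x y, step x y → ∃ g ∈ supp x, ∀ h ∈ supp y, h ∈ supp x ∧ h ≠ g ∨ r h g) :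
    ¬ ∃ z : ℕ → A, ∀ n, step (z n) (z (n + 1)) := by
  classical
  -- The multiset only bounds the support from above, which absorbs cancellations and repeated
  -- elements.
  have key : ∀ M : Multiset ι, ∀ z : ℕ → A, (∀ n, step (z n) (z (n + 1))) →
      (∀ h ∈ supp (z 0), h ∈ M) → False := by
    intro M
    induction M using hr.cutExpand.induction with
    | _ M ih =>
      intro z hz hM
      obtain ⟨g, hg, hy⟩ := hstep _ _ (hz 0)
      -- One copy of `g` is traded for all elements of the next support that lie below it, a step of
      -- `Relation.CutExpand`.
      let T := (hfin (z 1)).toFinset.filter fun h => r h g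
      refine ih (M.erase g + T.val) ⟨T.val, g, fun h hh => ?_, ?_⟩ (fun n => z (n + 1))
        (fun n => hz (n + 1)) fun h hh => ?_
      · exact (Finset.mem_filter.1 hh).2
      · rw [add_right_comm, add_comm (M.erase g), Multiset.singleton_add,
          Multiset.cons_erase (hM g hg)]
      · rcases hy h hh with ⟨hx, hne⟩ | hrg
        · exact Multiset.mem_add.2 (.inl ((Multiset.mem_erase_of_ne hne).2 (hM h hx)))
        · exact Multiset.mem_add.2 (.inr (Finset.mem_filter.2
            ⟨(hfin (z 1)).mem_toFinset.2 hh, hrg⟩))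
  rintro ⟨z, hz⟩
  exact key (hfin (z 0)).toFinset.val z hz fun h hh =>
    (hfin (z 0)).mem_toFinset.2 hh

end

end SuperRewriting

theorem theoremT {V : Type*} [Quiver V] {𝕜 : Type*} [Field 𝕜] (h2 : (2 : 𝕜) ≠ 0)
    (P : SuperRewriting.ThreeTwoSuperpolygraph V 𝕜) (hP : P.LeftMonomial)
    (X : SuperRewriting.OrdFunctor P.U) (Y : SuperRewriting.OrdCofunctor P.U)
    (hX : ∀ {a b : V} (e : a ⟶ b), Nonempty (X.obj e.toPath))
    (hY : ∀ {a b : V} (e : a ⟶ b), Nonempty (Y.obj e.toPath))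
    (hXα : ∀ {a b : V} {p q : Quiver.Path a b} (α : P.Gen₃ p q),
      ∀ g ∈ (P.src α).Supp, ∀ h ∈ (P.tgt α).Supp, ∀ x : X.obj p, X.map h x ≤ X.map g x)
    (hYα : ∀ {a b : V} {p q : Quiver.Path a b} (α : P.Gen₃ p q),
      ∀ g ∈ (P.src α).Supp, ∀ h ∈ (P.tgt α).Supp, ∀ y : Y.obj q, Y.map h y ≤ Y.map g y)
    {G : Type*} [AddCommGroup G] [PartialOrder G] [IsOrderedAddMonoid G]
    (hG : ∀ s : ℕ → G, Antitone s → (∀ n, 0 ≤ s n) → ∃ N, ∀ n, N ≤ n → s n = s N)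
    (D : SuperRewriting.ModuleDerivation X Y G)
    (hD : ∀ {a b : V} {p q : Quiver.Path a b} (g : SuperRewriting.Cell P.U p q)
      (z : X.obj p × Y.obj q), 0 ≤ D.d g z)
    (hDα : ∀ {a b : V} {p q : Quiver.Path a b} (α : P.Gen₃ p q),
      ∀ g ∈ (P.src α).Supp, ∀ h ∈ (P.tgt α).Supp,
        ∀ z : X.obj p × Y.obj q, D.d h z < D.d g z) :
    P.Terminates := by
  intro a b p q
  -- The boundary is constant along a sequence, so a single point of `X(p) × Y(q)` serves to weigh
  -- all 2-cells.
  obtain ⟨x⟩ := X.toOrdFamily.nonempty_obj hX p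
  obtain ⟨y⟩ := Y.toOrdFamily.nonempty_obj hY q
  refine SuperRewriting.not_exists_seq_of_supp SuperRewriting.SCell.finite_supp
    (SuperRewriting.wellFounded_lt_of_stationary hG (fun g => D.d g (x, y)) fun g => hD g _)
    fun _ _ h => h.exists_supp hP _ ?_
  intro _ _ _ _ α u hu v hv _ _ _ _ m₁ m₂ m₃ m₄
  exact D.d_plug_lt m₁ m₂ m₃ m₄ (hXα α v hv u hu) (hYα α v hv u hu) (hDα α v hv u hu) x y
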